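/- Let $H^{(2)}_n=\sum_{0<k\le n}1/k^2$ for $n\ge 0$ be the harmonic numbers of the second order, and let the Euler numbers $E_0,E_1,E_2,\ldots$ be given by $E_0=1$ and $\sum_{0\le k\le n,\ 2\mid k}\binom nk E_{n-k}=0$ for $n\ge 1$. For rational numbers $a,b$ and a prime $p$, write $a\equiv b\pmod p$ if $a-b=pc$ for some rational number $c$ whose denominator is not divisible by $p$. Let $p>3$ be a prime. Then $$\sum_{k=0}^{p-1}\frac{\binom{2k}{k}}{2^k}H^{(2)}_k\equiv -E_{p-3}\pmod p.$$ Moreover, this congruence is equivalent to $$p\sum_{k=1}^{p-1}\frac{2^kH^{(2)}_{k-1}}{k\binom{2k}{k}}\equiv E_{p-3}\pmod p$$ (so both congruences hold). -/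

import Mathlib

/-- The Euler numbers `E_0, E_1, E_2, …`, given by `E_0 = 1` and, for `n ≥ 1`,
`∑_{0 ≤ k ≤ n, 2 ∣ k} (n choose k) E_{n-k} = 0`, solved here for the term with `k = 0`. -/
def eulerNumber : ℕ → ℤ
  | 0 => 1
  | n + 1 => -∑ k : Fin (n + 1),
      if Even ((k : ℕ) + 1) then ((n + 1).choose (k + 1) : ℤ) * eulerNumber (n - k) else 0
  termination_by n => n
  decreasing_by omega

theorem eulerNumber_zero : eulerNumber 0 = 1 := by
  rw [eulerNumber]

/-- The defining recursion of the Euler numbers. -/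
theorem sum_choose_mul_eulerNumber (n : ℕ) (hn : 1 ≤ n) :
    ∑ k ∈ (Finset.range (n + 1)).filter Even, (n.choose k : ℤ) * eulerNumber (n - k) = 0 := by
  obtain ⟨m, rfl⟩ : ∃ m, n = m + 1 := ⟨n - 1, by omega⟩
  rw [Finset.sum_filter, Finset.sum_range_succ']
  simp only [Even.zero, if_true, Nat.choose_zero_right, Nat.cast_one, one_mul, Nat.sub_zero]
  rw [eulerNumber, Finset.sum_range]
  simp only [Nat.add_sub_add_right]
  ring

/-- The harmonic numbers of the second order, `H_n^{(2)} = ∑_{0 < k ≤ n} 1 / k²`. -/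
def harmonicTwo (n : ℕ) : ℚ := ∑ k ∈ Finset.Icc 1 n, 1 / (k : ℚ) ^ 2

/-- Congruence of rational numbers modulo a natural number `m`: `a - b` is `m` times a
rational number whose denominator (in lowest terms) is coprime to `m`. -/
def RatModEq (m : ℕ) (a b : ℚ) : Prop :=
  ∃ c : ℚ, Nat.Coprime c.den m ∧ a - b = (m : ℚ) * c

/-! Write p = 2n+1. Modulo p, binom(2k,k) ≡ (-4)^k binom(n,k), so the first sum becomes the binomial
transform ∑ binom(n,k) (-2)^k H_k^(2). By `binomialTransform_harmonic_two` this is (-1)^n (W - V),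
where W = ∑_{m≤n} (-1)^m/m ∑_{j≤m} (-1)^j/j and V has 1/j in place of (-1)^j/j. Put A = ∑_{m≤n}
(-1)^m/m. By symmetry 2W ≡ A². Partial fractions and the reflection m ↦ p - m give A² ≡ 2V - ∑_{m≤n}
(-1)^m/m² (`sum_neg_one_pow_inv_sq`, `sum_neg_one_pow_harmonic`). The last sum is 2(-1)^n E_{p-3} by
an umbral computation (`sum_neg_one_pow_div_sq`), so W - V ≡ -(-1)^n E_{p-3}.

In the second sum the terms k ≤ n vanish because of the factor p, and the term k = p - j is minus
the j-th term of the first sum (`ratReducesTo_upper_term`). Both congruences are thus proved, and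
the equivalence follows. -/

/-- The rational `q` is `p`-integral and reduces to `z` modulo `p`. -/
def RatReducesTo (p : ℕ) [Fact p.Prime] (q : ℚ) (z : ZMod p) : Prop :=
  (q.den : ZMod p) ≠ 0 ∧ (q : ZMod p) = z

/-! ### Reduction of p-integral rationals to `ZMod p`. -/

namespace RatReducesTo

variable {p : ℕ} [Fact p.Prime] {a b : ℚ} {y z : ZMod p}

theorem den_dvd_ne_zero {d e : ℕ} (h : d ∣ e) (he : (e : ZMod p) ≠ 0) : (d : ZMod p) ≠ 0 := by
  obtain ⟨c, rfl⟩ := h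
  intro h0
  apply he
  rw [Nat.cast_mul, h0, zero_mul]

theorem add (ha : RatReducesTo p a y) (hb : RatReducesTo p b z) :
    RatReducesTo p (a + b) (y + z) := by
  refine ⟨den_dvd_ne_zero (Rat.add_den_dvd a b) ?_, ?_⟩
  · rw [Nat.cast_mul]
    exact mul_ne_zero ha.1 hb.1
  · rw [Rat.cast_add_of_ne_zero ha.1 hb.1, ha.2, hb.2]

theorem mul (ha : RatReducesTo p a y) (hb : RatReducesTo p b z) :
    RatReducesTo p (a * b) (y * z) := by
  refine ⟨den_dvd_ne_zero (Rat.mul_den_dvd a b) ?_, ?_⟩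
  · rw [Nat.cast_mul]
    exact mul_ne_zero ha.1 hb.1
  · rw [Rat.cast_mul_of_ne_zero ha.1 hb.1, ha.2, hb.2]

theorem intCast (m : ℤ) : RatReducesTo p m m := by
  refine ⟨?_, by simp⟩
  simp

theorem natCast (m : ℕ) : RatReducesTo p m m := by
  simpa using intCast (p := p) m

theorem neg (ha : RatReducesTo p a y) : RatReducesTo p (-a) (-y) := by
  simpa using (intCast (p := p) (-1)).mul ha

theorem sub (ha : RatReducesTo p a y) (hb : RatReducesTo p b z) :
    RatReducesTo p (a - b) (y - z) := by
  simpa [sub_eq_add_neg] using ha.add hb.neg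

theorem inv_natCast {m : ℕ} (hm : (m : ZMod p) ≠ 0) : RatReducesTo p (m : ℚ)⁻¹ (m : ZMod p)⁻¹ := by
  have hm0 : m ≠ 0 := by
    rintro rfl
    simp at hm
  refine ⟨?_, ?_⟩
  · rw [Rat.inv_natCast_den_of_pos (Nat.pos_of_ne_zero hm0)]
    exact hm
  · rw [Rat.cast_inv_of_ne_zero] <;> simp [hm]

theorem pow (ha : RatReducesTo p a y) (k : ℕ) : RatReducesTo p (a ^ k) (y ^ k) := by
  induction k with
  | zero => simpa using natCast (p := p) 1
  | succ k ih => simpa [pow_succ] using ih.mul ha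

theorem sum {ι : Type*} {s : Finset ι} {f : ι → ℚ} {g : ι → ZMod p}
    (h : ∀ i ∈ s, RatReducesTo p (f i) (g i)) :
    RatReducesTo p (∑ i ∈ s, f i) (∑ i ∈ s, g i) := by
  classical
  induction s using Finset.induction_on with
  | empty => simpa using natCast (p := p) 0
  | insert i s hi ih =>
    rw [Finset.sum_insert hi, Finset.sum_insert hi]
    exact (h i (by simp)).add (ih fun j hj => h j (by simp [hj]))

theorem ratModEq (ha : RatReducesTo p a z) (hb : RatReducesTo p b z) : RatModEq p a b := by
  have hp : p.Prime := Fact.out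
  obtain ⟨hd, hc⟩ := ha.sub hb
  rw [sub_self, Rat.cast_def, div_eq_zero_iff, or_iff_left hd, ZMod.intCast_zmod_eq_zero_iff_dvd] at hc
  obtain ⟨m, hm⟩ := hc
  refine ⟨Rat.divInt m (a - b).den, ?_, ?_⟩
  · have h1 : Nat.Coprime (a - b).den p := by
      rw [Nat.coprime_comm, hp.coprime_iff_not_dvd, ← ZMod.natCast_eq_zero_iff]
      exact hd
    have h2 := Rat.den_dvd m (a - b).den
    exact Nat.Coprime.coprime_dvd_left (by exact_mod_cast h2) h1
  · conv_lhs => rw [← Rat.num_div_den (a - b), hm]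
    rw [Rat.divInt_eq_div]
    push_cast
    ring

end RatReducesTo
-- Euler numbers and alternating power sums.
open Polynomial in
/-- The umbral functional sending `X ^ k` to the Euler number `E_k`. -/
noncomputable def eulerFunctional (R : Type*) [CommRing R] : R[X] →ₗ[R] R :=
  Polynomial.lsum fun k => (eulerNumber k : R) • LinearMap.id

section Euler

open Polynomial

variable {R : Type*} [CommRing R]

theorem eulerFunctional_C_mul_X_pow (a : R) (k : ℕ) :
    eulerFunctional R (C a * X ^ k) = a * eulerNumber k := by
  rw [C_mul_X_pow_eq_monomial, eulerFunctional, Polynomial.lsum_apply,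
    Polynomial.sum_monomial_index] <;> simp [mul_comm]

theorem eulerFunctional_X_add_C_pow (a : R) (r : ℕ) :
    eulerFunctional R ((X + C a) ^ r) =
      ∑ k ∈ Finset.range (r + 1), a ^ (r - k) * r.choose k * eulerNumber k := by
  rw [add_pow, map_sum]
  refine Finset.sum_congr rfl fun k _ => ?_
  rw [← eulerFunctional_C_mul_X_pow]
  congr 1
  simp only [map_mul, map_pow, map_natCast]
  ring

/-- The defining recursion in umbral form: in (E+1)^s + (E-1)^s the odd powers of the shift cancel
and the even ones double. -/
theorem eulerFunctional_X_add_one_pow_add (s : ℕ) :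
    eulerFunctional R ((X + C 1) ^ s + (X + C (-1)) ^ s) = if s = 0 then 2 else 0 := by
  rcases Nat.eq_zero_or_pos s with rfl | hs
  · have := eulerFunctional_C_mul_X_pow (2 : R) 0
    simp only [pow_zero, mul_one, eulerNumber_zero, Int.cast_one] at this
    simpa [one_add_one_eq_two, ← C_ofNat] using this
  · rw [if_neg hs.ne', map_add, eulerFunctional_X_add_C_pow, eulerFunctional_X_add_C_pow,
      ← Finset.sum_add_distrib, ← Finset.sum_range_reflect]
    have h := congrArg (fun z : ℤ => 2 * (z : R)) (sum_choose_mul_eulerNumber s hs)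
    simp only [Int.cast_zero, mul_zero] at h
    rw [← h, Finset.sum_filter, Int.cast_sum, Finset.mul_sum]
    refine Finset.sum_congr rfl fun k hk => ?_
    have hk' : k ≤ s := by simpa [Nat.lt_succ_iff] using hk
    rw [show s + 1 - 1 - k = s - k by omega, Nat.choose_symm hk', Nat.sub_sub_self hk']
    by_cases he : Even k
    · simp only [one_pow, he.neg_one_pow, he, if_true]
      push_cast
      ring
    · simp [he, (Nat.not_even_iff_odd.1 he).neg_one_pow]

/-- Expanding in powers of X ± 1, only the exponent s = 0 survives. -/
theorem eulerFunctional_shift (x : R) (r : ℕ) :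
    eulerFunctional R ((X + C (x + 1)) ^ r) + eulerFunctional R ((X + C (x - 1)) ^ r) =
      2 * x ^ r := by
  have key : ∀ c : R, (X + C (x + c)) ^ r =
      ∑ s ∈ Finset.range (r + 1), (x ^ (r - s) * (r.choose s : R)) • (X + C c) ^ s := by
    intro c
    rw [show (X + C (x + c) : R[X]) = (X + C c) + C x by rw [C_add]; ring, add_pow]
    refine Finset.sum_congr rfl fun s _ => ?_
    rw [smul_eq_C_mul]
    simp only [map_mul, map_pow, map_natCast]
    ring
  rw [sub_eq_add_neg, key, key, ← map_add, ← Finset.sum_add_distrib, map_sum]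
  simp only [← smul_add, map_smul, eulerFunctional_X_add_one_pow_add]
  rw [Finset.sum_eq_single 0]
  · simp [mul_comm]
  · intro s _ hs
    simp [hs]
  · simp

theorem eulerNumber_of_odd (n : ℕ) (hn : Odd n) : eulerNumber n = 0 := by
  induction n using Nat.strong_induction_on with
  | _ n ih =>
    have h := sum_choose_mul_eulerNumber n hn.pos
    rw [Finset.sum_eq_single 0] at h
    · simpa using h
    · intro k hk hk0
      simp only [Finset.mem_filter, Finset.mem_range] at hk
      rw [ih (n - k) (by have := hn.pos; omega) (Nat.Odd.sub_even (by omega) hn hk.2), mul_zero]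
    · simp

theorem eulerFunctional_even (a : R) (r : ℕ) (hr : Even r) :
    eulerFunctional R ((X + C (-a)) ^ r) = eulerFunctional R ((X + C a) ^ r) := by
  rw [eulerFunctional_X_add_C_pow, eulerFunctional_X_add_C_pow]
  refine Finset.sum_congr rfl fun k hk => ?_
  have hk' : k ≤ r := by simpa [Nat.lt_succ_iff] using hk
  rcases Nat.even_or_odd k with he | ho
  · have h : Even (r - k) := (Nat.even_sub hk').2 (iff_of_true hr he)
    rw [h.neg_pow a]
  · simp [eulerNumber_of_odd k ho]

/-- Telescoping of `eulerFunctional_shift` at x = 1, 3, 5, …. -/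
theorem eulerFunctional_alternating (r N : ℕ) :
    2 * ∑ i ∈ Finset.range N, (-1) ^ i * ((2 * i + 1 : ℕ) : R) ^ r =
      eulerNumber r - (-1) ^ N * eulerFunctional R ((X + C ((2 * N : ℕ) : R)) ^ r) := by
  induction N with
  | zero =>
    have := eulerFunctional_C_mul_X_pow (1 : R) r
    simp only [map_one, one_mul] at this
    simp [this]
  | succ N ih =>
    rw [Finset.sum_range_succ, mul_add, ih]
    have h := eulerFunctional_shift ((2 * N + 1 : ℕ) : R) r
    rw [show ((2 * N + 1 : ℕ) : R) + 1 = ((2 * (N + 1) : ℕ) : R) by push_cast; ring,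
      show ((2 * N + 1 : ℕ) : R) - 1 = ((2 * N : ℕ) : R) by push_cast; ring] at h
    rw [pow_succ]
    linear_combination (-1) ^ N * (-h)

end Euler

/-- By Fermat, x^(p-3) = x⁻² for x ≠ 0, so this is an alternating power sum over odd numbers, with m
= n - i and 2i+1 ≡ -2m. -/
theorem sum_neg_one_pow_div_sq {p n : ℕ} [Fact p.Prime] (hpn : p = 2 * n + 1) (hp3 : 3 < p) :
    ∑ m ∈ Finset.range (n + 1), (-1) ^ m * ((m : ZMod p)⁻¹) ^ 2 =
      2 * (-1) ^ n * (eulerNumber (p - 3) : ZMod p) := by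
  have h2 : (2 : ZMod p) ≠ 0 := by
    intro h
    have : ((2 : ℕ) : ZMod p) = 0 := by exact_mod_cast h
    rw [ZMod.natCast_eq_zero_iff] at this
    have := Nat.le_of_dvd (by norm_num) this
    omega
  have hp0 : (2 * n + 1 : ZMod p) = 0 := by
    have h : ((2 * n + 1 : ℕ) : ZMod p) = 0 := (ZMod.natCast_eq_zero_iff _ _).2 (dvd_of_eq hpn)
    exact_mod_cast h
  have hr : Even (p - 3) := ⟨n - 1, by omega⟩
  have inv_sq : ∀ x : ZMod p, x ≠ 0 → x ^ (p - 3) = x⁻¹ ^ 2 := by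
    intro x hx
    have h := ZMod.pow_card_sub_one_eq_one hx
    rw [show p - 1 = (p - 3) + 2 by omega, pow_add] at h
    rw [inv_pow]
    exact eq_inv_of_mul_eq_one_left h
  have h := eulerFunctional_alternating (R := ZMod p) (p - 3) n
  -- The boundary term is (E-1)^(p-3), since 2n ≡ -1. It equals (E+1)^(p-3) by parity, and the two
  -- add up to 2·0^(p-3) = 0.
  have h1 : eulerFunctional (ZMod p)
      ((Polynomial.X + Polynomial.C ((2 * n : ℕ) : ZMod p)) ^ (p - 3)) = 0 := by
    rw [show ((2 * n : ℕ) : ZMod p) = -1 by push_cast; linear_combination hp0]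
    have h := eulerFunctional_shift (0 : ZMod p) (p - 3)
    rw [zero_add, zero_sub, eulerFunctional_even 1 _ hr, zero_pow (by omega), mul_zero,
      ← two_mul] at h
    rw [eulerFunctional_even 1 _ hr]
    exact (mul_eq_zero.1 h).resolve_left h2
  rw [h1, mul_zero, sub_zero] at h
  rw [← h, Finset.sum_range_succ', ← Finset.sum_range_reflect]
  simp only [Nat.cast_zero, inv_zero, ne_eq, OfNat.ofNat_ne_zero, not_false_eq_true, zero_pow,
    mul_zero, add_zero, Finset.mul_sum]
  refine Finset.sum_congr rfl fun i hi => ?_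
  have hi' : i < n := Finset.mem_range.1 hi
  rw [show n - 1 - i + 1 = n - i by omega]
  have e1 : ((2 * i + 1 : ℕ) : ZMod p) = -(2 * ((n - i : ℕ) : ZMod p)) := by
    rw [Nat.cast_sub hi'.le]
    push_cast
    linear_combination hp0
  have e2 : ((2 * i + 1 : ℕ) : ZMod p) ≠ 0 := by
    rw [Ne, ZMod.natCast_eq_zero_iff]
    intro h
    have := Nat.le_of_dvd (by omega) h
    omega
  rw [inv_sq _ e2, e1, inv_neg, neg_sq, mul_inv, mul_pow]
  have e3 : (-1 : ZMod p) ^ n * (-1) ^ i = (-1) ^ (n - i) := by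
    rw [← pow_add, show n + i = (n - i) + 2 * i by omega, pow_add, pow_mul]
    simp
  rw [← e3]
  have : (2 : ZMod p) ^ 2 * (2⁻¹) ^ 2 = 1 := by
    rw [← mul_pow, mul_inv_cancel₀ h2, one_pow]
  linear_combination (-((-1 : ZMod p) ^ n * (-1) ^ i * (((n - i : ℕ) : ZMod p)⁻¹) ^ 2)) * this

/-! ### Binomial transforms of harmonic sequences. -/

/-- The binomial transform `∑_{k ≤ N} (N choose k) x ^ k u_k`. -/
def binomialTransform {R : Type*} [CommRing R] (x : R) (u : ℕ → R) (N : ℕ) : R :=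
  ∑ k ∈ Finset.range (N + 1), (N.choose k : R) * x ^ k * u k

section BinomialTransform

variable {R : Type*} [CommRing R]

theorem binomialTransform_zero (x : R) (u : ℕ → R) : binomialTransform x u 0 = u 0 := by
  simp [binomialTransform]

theorem binomialTransform_one (x : R) (N : ℕ) :
    binomialTransform x (fun _ => 1) N = (1 + x) ^ N := by
  rw [add_comm 1 x, add_pow]
  exact Finset.sum_congr rfl fun k _ => by simp [mul_comm]

theorem binomialTransform_add (x : R) (u v : ℕ → R) (N : ℕ) :
    binomialTransform x (fun k => u k + v k) N =
      binomialTransform x u N + binomialTransform x v N := by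
  simp only [binomialTransform, mul_add, Finset.sum_add_distrib]

theorem binomialTransform_congr (x : R) {u v : ℕ → R} {N : ℕ} (h : ∀ k ≤ N, u k = v k) :
    binomialTransform x u N = binomialTransform x v N :=
  Finset.sum_congr rfl fun k hk => by rw [h k (Nat.lt_succ_iff.1 (Finset.mem_range.1 hk))]

theorem binomialTransform_succ (x : R) (u : ℕ → R) (N : ℕ) :
    binomialTransform x u (N + 1) =
      binomialTransform x u N + x * binomialTransform x (fun k => u (k + 1)) N := by
  have h : binomialTransform x u N =
      ∑ k ∈ Finset.range (N + 2), (N.choose k : R) * x ^ k * u k := by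
    rw [Finset.sum_range_succ _ (N + 1)]
    simp [binomialTransform]
  rw [h, binomialTransform, binomialTransform, Finset.sum_range_succ' _ (N + 1),
    Finset.sum_range_succ' _ (N + 1), Finset.mul_sum, add_right_comm, ← Finset.sum_add_distrib]
  congr 1
  · refine Finset.sum_congr rfl fun k _ => ?_
    rw [Nat.choose_succ_succ]
    push_cast
    ring
  · simp

variable {K : Type*} [Field K]

/-- Absorption: (N+1) binom(N,k) = (k+1) binom(N+1,k+1). -/
theorem binomialTransform_div_succ (x : K) (v : ℕ → K) (N : ℕ)
    (hN : ∀ k ≤ N, ((k + 1 : ℕ) : K) ≠ 0) :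
    ((N + 1 : ℕ) : K) *
        (x * binomialTransform x (fun k => ((k + 1 : ℕ) : K)⁻¹ * v (k + 1)) N) =
      binomialTransform x v (N + 1) - v 0 := by
  rw [binomialTransform, binomialTransform, Finset.sum_range_succ' _ (N + 1), Finset.mul_sum,
    Finset.mul_sum]
  simp only [Nat.choose_zero_right, Nat.cast_one, pow_zero, mul_one, one_mul, add_sub_cancel_right]
  refine Finset.sum_congr rfl fun k hk => ?_
  have h0 := hN k (Nat.lt_succ_iff.1 (Finset.mem_range.1 hk))
  have h : ((N + 1 : ℕ) : K) * N.choose k = (N + 1).choose (k + 1) * ((k + 1 : ℕ) : K) := by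
    rw [← Nat.cast_mul, ← Nat.cast_mul, Nat.add_one_mul_choose_eq]
  have h1 := mul_inv_cancel₀ h0
  linear_combination (x ^ (k + 1) * ((k + 1 : ℕ) : K)⁻¹ * v (k + 1)) * h +
    (x ^ (k + 1) * v (k + 1) * (N + 1).choose (k + 1)) * h1

theorem binomialTransform_inv (N : ℕ) (hN : ∀ k < N, ((k + 1 : ℕ) : K) ≠ 0) :
    binomialTransform (-2 : K) (fun k => (k : K)⁻¹) N =
      ∑ j ∈ Finset.range (N + 1), ((-1) ^ j - 1) * (j : K)⁻¹ := by
  induction N with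
  | zero => simp [binomialTransform_zero]
  | succ N ih =>
    rw [binomialTransform_succ, ih fun k hk => hN k (by omega), Finset.sum_range_succ _ (N + 1)]
    congr 1
    have h := binomialTransform_div_succ (-2 : K) (fun _ => 1) N fun k hk => hN k (by omega)
    simp only [mul_one] at h
    rw [binomialTransform_one, show (1 + -2 : K) = -1 by ring] at h
    rw [← h, mul_comm (_ * _), ← mul_assoc, inv_mul_cancel₀ (hN N (by omega)), one_mul]

/-- Since 1 + x = -1 at x = -2, Pascal's rule gives T_{N+1} = -T_N plus the transform of 1/(k+1)²
times -2, which absorption reduces to `binomialTransform_inv`. Hence (-1)^N T_N telescopes. -/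
theorem binomialTransform_harmonic_two (N : ℕ) (hN : ∀ k < N, ((k + 1 : ℕ) : K) ≠ 0) :
    binomialTransform (-2 : K) (fun k => ∑ i ∈ Finset.range (k + 1), ((i : K)⁻¹) ^ 2) N =
      (-1) ^ N * ∑ m ∈ Finset.range (N + 1), (-1) ^ m * (m : K)⁻¹ *
        ∑ j ∈ Finset.range (m + 1), ((-1) ^ j - 1) * (j : K)⁻¹ := by
  induction N with
  | zero => simp [binomialTransform_zero]
  | succ N ih =>
    have hB := binomialTransform_inv (N + 1) hN
    have h := binomialTransform_div_succ (-2 : K) (fun k => (k : K)⁻¹) N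
      fun k hk => hN k (by omega)
    have h0 := inv_mul_cancel₀ (hN N (by omega))
    rw [hB, Nat.cast_zero, inv_zero, sub_zero] at h
    rw [binomialTransform_succ, binomialTransform_congr (-2) (N := N)
      (u := fun k => ∑ i ∈ Finset.range (k + 1 + 1), ((i : K)⁻¹) ^ 2)
      (v := fun k => ∑ i ∈ Finset.range (k + 1), ((i : K)⁻¹) ^ 2 +
        ((k + 1 : ℕ) : K)⁻¹ * ((k + 1 : ℕ) : K)⁻¹)
      (fun k _ => by rw [Finset.sum_range_succ, sq (((k + 1 : ℕ) : K)⁻¹)]),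
      binomialTransform_add, ih fun k hk => hN k (by omega), Finset.sum_range_succ _ (N + 1), ← h]
    have e : ((-1 : K) ^ N) * (-1) ^ N = 1 := by
      rw [← mul_pow]
      simp
    generalize binomialTransform (-2 : K)
      (fun k => ((k + 1 : ℕ) : K)⁻¹ * ((k + 1 : ℕ) : K)⁻¹) N = t at *
    rw [pow_succ]
    linear_combination (2 * t) * h0 + (2 * t * (((N + 1 : ℕ) : K)⁻¹ * ((N + 1 : ℕ) : K))) * e

end BinomialTransform

theorem sum_range_mul_sum_range_succ {R : Type*} [CommRing R] (c : ℕ → R) (N : ℕ) :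
    2 * ∑ m ∈ Finset.range N, c m * ∑ j ∈ Finset.range (m + 1), c j =
      (∑ m ∈ Finset.range N, c m) ^ 2 + ∑ m ∈ Finset.range N, c m ^ 2 := by
  induction N with
  | zero => simp
  | succ N ih =>
    rw [Finset.sum_range_succ, mul_add, ih, Finset.sum_range_succ c N,
      Finset.sum_range_succ (fun m => c m ^ 2)]
    ring

/-- Pairs m with p - m. The index m = 0 is excluded because its partner p lies outside the range. -/
theorem sum_range_two_mul_add_one {R : Type*} [CommRing R] {p n : ℕ} (hpn : p = 2 * n + 1)
    (g : ℕ → R) (hg : g 0 = 0) :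
    ∑ m ∈ Finset.range p, g m = ∑ m ∈ Finset.range (n + 1), (if m = 0 then 0 else g m + g (p - m)) := by
  subst hpn
  rw [Finset.sum_range_succ', hg, add_zero, two_mul, Finset.sum_range_add, Finset.sum_range_succ']
  simp only [if_true, add_zero, Nat.add_eq_zero_iff, one_ne_zero, and_false, if_false,
    Finset.sum_add_distrib]
  congr 1
  rw [← Finset.sum_range_reflect]
  refine Finset.sum_congr rfl fun i hi => ?_
  have := Finset.mem_range.1 hi
  congr 1
  omega

/-! ### Harmonic sums modulo p. Sums may start at index 0 because 0⁻¹ = 0. -/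

section Prime

variable {p n : ℕ} [Fact p.Prime]

theorem ZMod.natCast_ne_zero_of_lt {k : ℕ} (h0 : 0 < k) (hk : k < p) : (k : ZMod p) ≠ 0 := by
  rw [Ne, ZMod.natCast_eq_zero_iff]
  exact Nat.not_dvd_of_pos_of_lt h0 hk

theorem ZMod.natCast_sub_self {k : ℕ} (hk : k ≤ p) : ((p - k : ℕ) : ZMod p) = -k := by
  rw [Nat.cast_sub hk, ZMod.natCast_self, zero_sub]

theorem neg_one_pow_prime_sub (hpn : p = 2 * n + 1) {k : ℕ} (hk : k ≤ p) :
    (-1 : ZMod p) ^ (p - k) = -(-1) ^ k := by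
  have h : (-1 : ZMod p) ^ (p - k) * (-1) ^ k = -1 := by
    rw [← pow_add, Nat.sub_add_cancel hk]
    exact Odd.neg_one_pow ⟨n, hpn⟩
  have e : ((-1 : ZMod p) ^ k) * (-1) ^ k = 1 := by
    rw [← mul_pow]
    simp
  linear_combination (-1 : ZMod p) ^ k * h - (-1 : ZMod p) ^ (p - k) * e

theorem two_ne_zero_zmod (hpn : p = 2 * n + 1) (hp3 : 3 < p) : (2 : ZMod p) ≠ 0 := by
  have := ZMod.natCast_ne_zero_of_lt (p := p) (k := 2) (by omega) (by omega)
  exact_mod_cast this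

theorem sum_range_prime_eq_sum_zmod (f : ZMod p → ZMod p) :
    ∑ m ∈ Finset.range p, f m = ∑ x : ZMod p, f x := by
  refine Finset.sum_nbij' (fun m => (m : ZMod p)) ZMod.val ?_ ?_ ?_ ?_ ?_
  · simp
  · intro x _
    simpa using ZMod.val_lt x
  · intro m hm
    exact ZMod.val_cast_of_lt (Finset.mem_range.1 hm)
  · intro x _
    simp
  · simp

theorem sum_inv_eq_zero (hpn : p = 2 * n + 1) : ∑ m ∈ Finset.range p, (m : ZMod p)⁻¹ = 0 := by
  rw [sum_range_two_mul_add_one hpn _ (by simp)]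
  refine Finset.sum_eq_zero fun m hm => ?_
  have := Finset.mem_range.1 hm
  rw [ZMod.natCast_sub_self (by omega), inv_neg]
  simp

/-- Inversion permutes the field, and ∑ x² = 0 because 2 < p - 1. -/
theorem sum_inv_sq_eq_zero (hp3 : 3 < p) :
    ∑ m ∈ Finset.range p, ((m : ZMod p)⁻¹) ^ 2 = 0 := by
  rw [sum_range_prime_eq_sum_zmod fun x => x⁻¹ ^ 2]
  refine (Equiv.sum_comp (Equiv.inv (ZMod p)) fun x => x ^ 2).trans ?_
  exact FiniteField.sum_pow_lt_card_sub_one _ 2 (by rw [ZMod.card]; omega)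

theorem sum_inv_sq_half_eq_zero (hpn : p = 2 * n + 1) (hp3 : 3 < p) :
    ∑ m ∈ Finset.range (n + 1), ((m : ZMod p)⁻¹) ^ 2 = 0 := by
  have h := sum_inv_sq_eq_zero (p := p) hp3
  rw [sum_range_two_mul_add_one hpn _ (by simp)] at h
  have h2 := two_ne_zero_zmod hpn hp3
  refine (mul_eq_zero.1 ?_).resolve_left h2
  rw [← h, Finset.mul_sum]
  refine Finset.sum_congr rfl fun m hm => ?_
  have := Finset.mem_range.1 hm
  rw [ZMod.natCast_sub_self (by omega), inv_neg]
  split_ifs with h0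
  · simp [h0]
  · ring

theorem sum_neg_one_pow_inv_sq_eq_zero (hpn : p = 2 * n + 1) :
    ∑ m ∈ Finset.range p, (-1) ^ m * ((m : ZMod p)⁻¹) ^ 2 = 0 := by
  rw [sum_range_two_mul_add_one hpn _ (by simp)]
  refine Finset.sum_eq_zero fun m hm => ?_
  have := Finset.mem_range.1 hm
  rw [ZMod.natCast_sub_self (by omega), inv_neg, neg_one_pow_prime_sub hpn (by omega)]
  simp

theorem sum_neg_one_pow_inv (hpn : p = 2 * n + 1) :
    ∑ m ∈ Finset.range p, (-1) ^ m * (m : ZMod p)⁻¹ =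
      2 * ∑ m ∈ Finset.range (n + 1), (-1) ^ m * (m : ZMod p)⁻¹ := by
  rw [sum_range_two_mul_add_one hpn _ (by simp), Finset.mul_sum]
  refine Finset.sum_congr rfl fun m hm => ?_
  have := Finset.mem_range.1 hm
  rw [ZMod.natCast_sub_self (by omega), inv_neg, neg_one_pow_prime_sub hpn (by omega)]
  split_ifs with h0
  · simp [h0]
  · ring

theorem sum_inv_reflect (hpn : p = 2 * n + 1) {k : ℕ} (hk : k < p) :
    ∑ i ∈ Finset.range (p - k), (i : ZMod p)⁻¹ = ∑ i ∈ Finset.range (k + 1), (i : ZMod p)⁻¹ := by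
  induction k with
  | zero => simp [sum_inv_eq_zero hpn]
  | succ k ih =>
    have h := ih (by omega)
    rw [show p - k = p - (k + 1) + 1 by omega, Finset.sum_range_succ,
      ZMod.natCast_sub_self (by omega), inv_neg] at h
    rw [Finset.sum_range_succ _ (k + 1)]
    linear_combination h

theorem sum_inv_sq_reflect (hp3 : 3 < p) {k : ℕ} (hk : k < p) :
    ∑ i ∈ Finset.range (p - k), ((i : ZMod p)⁻¹) ^ 2 =
      -∑ i ∈ Finset.range (k + 1), ((i : ZMod p)⁻¹) ^ 2 := by
  induction k with
  | zero => rw [Nat.sub_zero, sum_inv_sq_eq_zero hp3]; simp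
  | succ k ih =>
    have h := ih (by omega)
    rw [show p - k = p - (k + 1) + 1 by omega, Finset.sum_range_succ,
      ZMod.natCast_sub_self (by omega), inv_neg] at h
    rw [Finset.sum_range_succ _ (k + 1)]
    linear_combination h

/-- Under m ↦ p - m the factor (-1)^m/m is unchanged, while H_{p-m} ≡ H_{m-1} = H_m - 1/m. The shift
by 1/m produces the correction sum. -/
theorem sum_neg_one_pow_harmonic (hpn : p = 2 * n + 1) :
    ∑ m ∈ Finset.range p, (-1) ^ m * (m : ZMod p)⁻¹ * ∑ j ∈ Finset.range (m + 1), (j : ZMod p)⁻¹ =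
      2 * (∑ m ∈ Finset.range (n + 1),
        (-1) ^ m * (m : ZMod p)⁻¹ * ∑ j ∈ Finset.range (m + 1), (j : ZMod p)⁻¹) -
      ∑ m ∈ Finset.range (n + 1), (-1) ^ m * ((m : ZMod p)⁻¹) ^ 2 := by
  rw [sum_range_two_mul_add_one hpn _ (by simp), Finset.mul_sum, ← Finset.sum_sub_distrib]
  refine Finset.sum_congr rfl fun m hm => ?_
  have := Finset.mem_range.1 hm
  split_ifs with h0
  · simp [h0]
  · rw [ZMod.natCast_sub_self (by omega), inv_neg, neg_one_pow_prime_sub hpn (by omega),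
      show p - m + 1 = p - (m - 1) by omega, sum_inv_reflect hpn (by omega),
      show m - 1 + 1 = m by omega, Finset.sum_range_succ]
    ring

/-- Partial fractions: 1/(m(s-m)) = (1/s)(1/m + 1/(s-m)). -/
theorem sum_antidiagonal_inv_mul_inv {s : ℕ} (hs : s < p) :
    ∑ m ∈ Finset.range (s + 1), (m : ZMod p)⁻¹ * ((s - m : ℕ) : ZMod p)⁻¹ =
      2 * (s : ZMod p)⁻¹ * (∑ j ∈ Finset.range (s + 1), (j : ZMod p)⁻¹ - (s : ZMod p)⁻¹) := by
  rcases Nat.eq_zero_or_pos s with rfl | h0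
  · simp
  have hterm : ∀ m ∈ Finset.range s, (m : ZMod p)⁻¹ * ((s - m : ℕ) : ZMod p)⁻¹ =
      (s : ZMod p)⁻¹ * ((m : ZMod p)⁻¹ + if m = 0 then 0 else ((s - m : ℕ) : ZMod p)⁻¹) := by
    intro m hm
    have hm' := Finset.mem_range.1 hm
    split_ifs with hm0
    · simp [hm0]
    · have h1 := ZMod.natCast_ne_zero_of_lt (p := p) h0 hs
      have h2 := ZMod.natCast_ne_zero_of_lt (p := p) (k := m) (by omega) (by omega)
      have h3 := ZMod.natCast_ne_zero_of_lt (p := p) (k := s - m) (by omega) (by omega)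
      have h4 : ((s - m : ℕ) : ZMod p) = s - m := Nat.cast_sub hm'.le
      field_simp
      rw [h4]
      ring
  have hrefl : ∑ m ∈ Finset.range s, (if m = 0 then 0 else ((s - m : ℕ) : ZMod p)⁻¹) =
      ∑ m ∈ Finset.range s, (m : ZMod p)⁻¹ := by
    obtain ⟨t, rfl⟩ : ∃ t, s = t + 1 := ⟨s - 1, by omega⟩
    rw [Finset.sum_range_succ', Finset.sum_range_succ' (fun m : ℕ => (m : ZMod p)⁻¹),
      ← Finset.sum_range_reflect]
    simp only [if_true, Nat.cast_zero, inv_zero, Nat.add_eq_zero_iff, one_ne_zero, and_false,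
      if_false]
    congr 1
    refine Finset.sum_congr rfl fun i hi => ?_
    have := Finset.mem_range.1 hi
    rw [show t + 1 - (t - 1 - i + 1) = i + 1 by omega]
  rw [Finset.sum_range_succ, Finset.sum_range_succ _ s, Finset.sum_congr rfl hterm,
    ← Finset.mul_sum, Finset.sum_add_distrib, hrefl, Nat.sub_self, Nat.cast_zero, inv_zero]
  ring

/-- A shuffle relation for alternating double sums modulo `p`. -/
theorem sum_neg_one_pow_inv_sq (hpn : p = 2 * n + 1) (hp3 : 3 < p) :
    (∑ m ∈ Finset.range p, (-1) ^ m * (m : ZMod p)⁻¹) ^ 2 =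
      4 * ∑ s ∈ Finset.range p,
        (-1) ^ s * (s : ZMod p)⁻¹ * ∑ j ∈ Finset.range (s + 1), (j : ZMod p)⁻¹ := by
  set t : ℕ × ℕ → ZMod p := fun q =>
    ((-1) ^ q.1 * (q.1 : ZMod p)⁻¹) * ((-1) ^ q.2 * (q.2 : ZMod p)⁻¹) with ht
  set P := Finset.Ico 1 p ×ˢ Finset.Ico 1 p with hP
  have hIco : ∑ m ∈ Finset.range p, (-1) ^ m * (m : ZMod p)⁻¹ =
      ∑ m ∈ Finset.Ico 1 p, (-1) ^ m * (m : ZMod p)⁻¹ := by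
    rw [Finset.range_eq_Ico, Finset.sum_eq_sum_Ico_succ_bot (by omega)]
    simp
  have hlow : ∑ q ∈ P with q.1 + q.2 < p, t q =
      ∑ s ∈ Finset.range p, ∑ m ∈ Finset.range (s + 1),
        (-1) ^ s * ((m : ZMod p)⁻¹ * ((s - m : ℕ) : ZMod p)⁻¹) := by
    rw [Finset.sum_sigma']
    -- The indices m = 0 and m = s correspond to no pair, but their terms are zero.
    refine Finset.sum_bij_ne_zero (fun q _ _ => ⟨q.1 + q.2, q.1⟩) ?_ ?_ ?_ ?_
    · intro q hq _
      simp only [Finset.mem_filter, hP, Finset.mem_product, Finset.mem_Ico] at hq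
      simp only [Finset.mem_sigma, Finset.mem_range]
      omega
    · intro q _ _ q' _ _ h
      simp only [Sigma.mk.injEq, heq_eq_eq] at h
      ext <;> omega
    · rintro ⟨s, m⟩ hsm hne
      simp only [Finset.mem_sigma, Finset.mem_range] at hsm
      have hm : m ≠ 0 := by
        rintro rfl
        simp at hne
      have hms : s - m ≠ 0 := by
        intro h
        simp [h] at hne
      refine ⟨(m, s - m), ?_, ?_, ?_⟩
      · simp only [Finset.mem_filter, hP, Finset.mem_product, Finset.mem_Ico]
        omega
      · have : (-1 : ZMod p) ^ s = (-1) ^ m * (-1) ^ (s - m) := by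
          rw [← pow_add, show m + (s - m) = s by omega]
        intro h
        apply hne
        simp only [ht] at h
        rw [this, ← h]
        ring
      · simp only [Sigma.mk.injEq, heq_eq_eq, and_true]
        omega
    · intro q _ _
      simp only [ht, Nat.add_sub_cancel_left, pow_add]
      ring
  -- Replacing both entries by their complements in p preserves each term: in each factor the sign
  -- and the inverse both change sign.
  have hhigh : ∑ q ∈ P with p < q.1 + q.2, t q = ∑ q ∈ P with q.1 + q.2 < p, t q := by
    refine Finset.sum_nbij' (fun q => (p - q.1, p - q.2)) (fun q => (p - q.1, p - q.2))
      ?_ ?_ ?_ ?_ ?_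
    · intro q hq
      simp only [Finset.mem_filter, hP, Finset.mem_product, Finset.mem_Ico] at hq ⊢
      omega
    · intro q hq
      simp only [Finset.mem_filter, hP, Finset.mem_product, Finset.mem_Ico] at hq ⊢
      omega
    · intro q hq
      simp only [Finset.mem_filter, hP, Finset.mem_product, Finset.mem_Ico] at hq
      ext <;> simp only <;> omega
    · intro q hq
      simp only [Finset.mem_filter, hP, Finset.mem_product, Finset.mem_Ico] at hq
      ext <;> simp only <;> omega
    · intro q hq
      simp only [Finset.mem_filter, hP, Finset.mem_product, Finset.mem_Ico] at hq
      simp only [ht]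
      rw [ZMod.natCast_sub_self (by omega), ZMod.natCast_sub_self (by omega),
        neg_one_pow_prime_sub hpn (by omega), neg_one_pow_prime_sub hpn (by omega), inv_neg,
        inv_neg]
      ring
  -- On the line q.1 + q.2 = p each term is 1/q.1².
  have hmid : ∑ q ∈ P with q.1 + q.2 = p, t q = 0 := by
    rw [← sum_inv_sq_eq_zero (p := p) hp3, Finset.range_eq_Ico,
      Finset.sum_eq_sum_Ico_succ_bot (by omega)]
    simp only [Nat.cast_zero, inv_zero, ne_eq, OfNat.ofNat_ne_zero, not_false_eq_true, zero_pow,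
      zero_add]
    refine Finset.sum_nbij' (fun q => q.1) (fun m => (m, p - m)) ?_ ?_ ?_ ?_ ?_
    · intro q hq
      simp only [Finset.mem_filter, hP, Finset.mem_product, Finset.mem_Ico] at hq ⊢
      omega
    · intro m hm
      simp only [Finset.mem_filter, hP, Finset.mem_product, Finset.mem_Ico] at hm ⊢
      omega
    · intro q hq
      simp only [Finset.mem_filter, hP, Finset.mem_product, Finset.mem_Ico] at hq
      ext <;> simp only; omega
    · simp
    · intro q hq
      simp only [Finset.mem_filter, hP, Finset.mem_product, Finset.mem_Ico] at hq
      simp only [ht]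
      have e : ((-1 : ZMod p) ^ q.1) * (-1) ^ q.1 = 1 := by
        rw [← mul_pow]
        simp
      rw [show q.2 = p - q.1 by omega, ZMod.natCast_sub_self (by omega),
        neg_one_pow_prime_sub hpn (by omega), inv_neg]
      linear_combination ((q.1 : ZMod p)⁻¹) ^ 2 * e
  have hsplit : ∑ q ∈ P, t q = (∑ q ∈ P with q.1 + q.2 < p, t q) +
      ((∑ q ∈ P with q.1 + q.2 = p, t q) + ∑ q ∈ P with p < q.1 + q.2, t q) := by
    simp only [Finset.sum_filter, ← Finset.sum_add_distrib]
    refine Finset.sum_congr rfl fun q _ => ?_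
    rcases lt_trichotomy (q.1 + q.2) p with h | h | h
    · simp [h, h.ne, h.not_gt]
    · simp [h]
    · simp [h, h.ne', h.not_gt]
  have hsum : ∑ s ∈ Finset.range p, ∑ m ∈ Finset.range (s + 1),
        (-1) ^ s * ((m : ZMod p)⁻¹ * ((s - m : ℕ) : ZMod p)⁻¹) =
      2 * ∑ s ∈ Finset.range p,
        (-1) ^ s * (s : ZMod p)⁻¹ * ∑ j ∈ Finset.range (s + 1), (j : ZMod p)⁻¹ := by
    -- Subtracting twice the vanishing sum ∑ (-1)^s/s² turns H_s into H_s - 1/s = H_{s-1}.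
    rw [← sub_zero (2 * Finset.sum _ _), ← mul_zero (2 : ZMod p), ← sum_neg_one_pow_inv_sq_eq_zero hpn, Finset.mul_sum,
      Finset.mul_sum, ← Finset.sum_sub_distrib]
    refine Finset.sum_congr rfl fun s hs => ?_
    rw [← Finset.mul_sum, sum_antidiagonal_inv_mul_inv (Finset.mem_range.1 hs)]
    ring
  rw [hIco, sq, Finset.sum_mul_sum, ← Finset.sum_product', hsplit, hmid, hhigh, hlow, hsum]
  ring

theorem binomialTransform_harmonic_two_half (hpn : p = 2 * n + 1) (hp3 : 3 < p) :
    binomialTransform (-2 : ZMod p) (fun k => ∑ i ∈ Finset.range (k + 1), ((i : ZMod p)⁻¹) ^ 2) n =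
      -(eulerNumber (p - 3) : ZMod p) := by
  rw [binomialTransform_harmonic_two n fun k hk =>
    ZMod.natCast_ne_zero_of_lt (Nat.succ_pos k) (by omega)]
  have hE := sum_neg_one_pow_div_sq hpn hp3
  have hU := sum_neg_one_pow_inv_sq hpn hp3
  rw [sum_neg_one_pow_inv hpn, sum_neg_one_pow_harmonic hpn, hE] at hU
  have hW := sum_range_mul_sum_range_succ (fun m : ℕ => (-1) ^ m * (m : ZMod p)⁻¹) (n + 1)
  have hsq : ∑ m ∈ Finset.range (n + 1), ((-1) ^ m * (m : ZMod p)⁻¹) ^ 2 = 0 := by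
    rw [← sum_inv_sq_half_eq_zero hpn hp3]
    refine Finset.sum_congr rfl fun m _ => ?_
    rw [mul_pow, ← pow_mul, mul_comm m 2, pow_mul]
    simp
  rw [hsq, add_zero] at hW
  have hsub : ∑ m ∈ Finset.range (n + 1), (-1) ^ m * (m : ZMod p)⁻¹ *
      ∑ j ∈ Finset.range (m + 1), ((-1) ^ j - 1) * (j : ZMod p)⁻¹ =
      ∑ m ∈ Finset.range (n + 1), (-1) ^ m * (m : ZMod p)⁻¹ *
        ∑ j ∈ Finset.range (m + 1), (-1) ^ j * (j : ZMod p)⁻¹ -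
      ∑ m ∈ Finset.range (n + 1), (-1) ^ m * (m : ZMod p)⁻¹ *
        ∑ j ∈ Finset.range (m + 1), (j : ZMod p)⁻¹ := by
    simp only [sub_mul, one_mul, Finset.sum_sub_distrib, mul_sub]
  have h2 := two_ne_zero_zmod hpn hp3
  have e : ((-1 : ZMod p) ^ n) * (-1) ^ n = 1 := by
    rw [← mul_pow]
    simp
  -- The factor 8 allows adding 8W = 4A² and 4A² = 8V - 8(-1)^n E_{p-3} without division.
  have h8 : (2 ^ 3 : ZMod p) ≠ 0 := pow_ne_zero _ h2
  refine mul_left_cancel₀ h8 ?_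
  rw [hsub]
  linear_combination (-1 : ZMod p) ^ n * (4 * hW + hU) - 8 * (eulerNumber (p - 3) : ZMod p) * e

end Prime

/-! ### Central binomial coefficients modulo p and the two sums. -/

section Prime

variable {p n : ℕ} [Fact p.Prime]

/-- Both sides have the same ratio of consecutive terms, as -4(n-k) ≡ 2(2k+1). -/
theorem ZMod.natCast_centralBinom (hpn : p = 2 * n + 1) {k : ℕ} (hk : k < p) :
    (k.centralBinom : ZMod p) = (-4) ^ k * n.choose k := by
  induction k with
  | zero => simp
  | succ k ih =>
    have h0 := ZMod.natCast_ne_zero_of_lt (p := p) (Nat.succ_pos k) hk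
    refine mul_left_cancel₀ h0 ?_
    have h1 : ((k + 1 : ℕ) : ZMod p) * (k + 1).centralBinom = 2 * (2 * k + 1) * k.centralBinom := by
      exact_mod_cast congrArg (Nat.cast : ℕ → ZMod p) (Nat.succ_mul_centralBinom_succ k)
    have h2 : (n.choose (k + 1) : ZMod p) * ((k + 1 : ℕ) : ZMod p) = n.choose k * (n - k) := by
      rcases le_or_gt k n with hkn | hkn
      · rw [← Nat.cast_sub hkn, ← Nat.cast_mul, ← Nat.cast_mul, Nat.choose_succ_right_eq]
      · simp [Nat.choose_eq_zero_of_lt hkn, Nat.choose_eq_zero_of_lt (hkn.trans (Nat.lt_succ_self k))]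
    have hp0 : (2 * n + 1 : ZMod p) = 0 := by
      have h : ((2 * n + 1 : ℕ) : ZMod p) = 0 := (ZMod.natCast_eq_zero_iff _ _).2 (dvd_of_eq hpn)
      exact_mod_cast h
    rw [h1, ih (by omega), pow_succ]
    linear_combination (4 * (-4 : ZMod p) ^ k) * h2 + 2 * (-4 : ZMod p) ^ k * n.choose k * hp0

theorem sum_centralBinom_mul_harmonic_two (hpn : p = 2 * n + 1) (hp3 : 3 < p) :
    ∑ k ∈ Finset.range (n + 1), (k.centralBinom : ZMod p) *
      (∑ i ∈ Finset.range (k + 1), ((i : ZMod p)⁻¹) ^ 2) * ((2 : ZMod p)⁻¹) ^ k =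
      -(eulerNumber (p - 3) : ZMod p) := by
  rw [← binomialTransform_harmonic_two_half hpn hp3, binomialTransform]
  refine Finset.sum_congr rfl fun k hk => ?_
  have := Finset.mem_range.1 hk
  rw [ZMod.natCast_centralBinom hpn (by omega), show (-4 : ZMod p) = (-2) * 2 by ring, mul_pow]
  have h : (2 : ZMod p) ^ k * (2⁻¹) ^ k = 1 := by
    rw [← mul_pow, mul_inv_cancel₀ (two_ne_zero_zmod hpn hp3), one_pow]
  linear_combination ((-2) ^ k * n.choose k *
    ∑ i ∈ Finset.range (k + 1), ((i : ZMod p)⁻¹) ^ 2) * h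

theorem ZMod.factorial_sub_mul_factorial {j : ℕ} (hj : j < p) :
    ((p - 1 - j).factorial : ZMod p) * j.factorial = (-1) ^ (j + 1) := by
  induction j with
  | zero => simp [ZMod.wilsons_lemma]
  | succ j ih =>
    have h := ih (by omega)
    rw [show p - 1 - j = p - 1 - (j + 1) + 1 by omega, Nat.factorial_succ, Nat.cast_mul,
      show p - 1 - (j + 1) + 1 = p - (j + 1) by omega, ZMod.natCast_sub_self (by omega)] at h
    rw [Nat.factorial_succ, Nat.cast_mul, pow_succ]
    linear_combination -h

/-- The upper half of the central binomial coefficients, divided by `p`. -/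
theorem exists_centralBinom_sub_eq_mul (hpn : p = 2 * n + 1) {j : ℕ} (h0 : 0 < j) (hj : j ≤ n) :
    ∃ c : ℕ, (p - j).centralBinom = p * c ∧
      (c : ZMod p) * (j * j.centralBinom) = -2 := by
  have hp : p.Prime := Fact.out
  have hne : ∀ k < p, (k.factorial : ZMod p) ≠ 0 := fun k hk => by
    rw [Ne, ZMod.natCast_eq_zero_iff, hp.dvd_factorial]
    omega
  have hdvd : p ∣ (p - j).centralBinom := by
    have h := Nat.choose_mul_factorial_mul_factorial (n := 2 * (p - j)) (k := p - j) (by omega)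
    rw [show 2 * (p - j) - (p - j) = p - j by omega] at h
    have h1 : p ∣ (2 * (p - j)).factorial := (hp.dvd_factorial).2 (by omega)
    have h2 : ¬ p ∣ (p - j).factorial := by
      rw [hp.dvd_factorial]
      omega
    rw [← h] at h1
    rcases hp.dvd_mul.1 h1 with h3 | h3
    · exact (hp.dvd_mul.1 h3).resolve_right h2
    · exact absurd h3 h2
  obtain ⟨c, hc⟩ := hdvd
  refine ⟨c, hc, ?_⟩
  -- (2p-2j)! = p · (p-1)! · (p+1)⋯(2p-2j), with p cancelled. Modulo p the last block is (p-2j)!.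
  have hfac : c * ((p - j).factorial * (p - j).factorial) =
      (p - 1).factorial * (p + 1).ascFactorial (p - 2 * j) := by
    have h := Nat.choose_mul_factorial_mul_factorial (n := 2 * (p - j)) (k := p - j) (by omega)
    rw [show 2 * (p - j) - (p - j) = p - j by omega, ← Nat.centralBinom_eq_two_mul_choose, hc,
      show 2 * (p - j) = p + (p - 2 * j) by omega, ← Nat.factorial_mul_ascFactorial,
      ← Nat.mul_factorial_pred hp.ne_zero] at h
    refine Nat.eq_of_mul_eq_mul_left hp.pos ?_
    rw [← mul_assoc, ← mul_assoc, h, mul_assoc]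
  have hasc : ∀ m : ℕ, ((p + 1).ascFactorial m : ZMod p) = m.factorial := by
    intro m
    induction m with
    | zero => simp
    | succ m ih =>
      rw [Nat.ascFactorial_succ, Nat.factorial_succ]
      push_cast
      rw [ih, ZMod.natCast_self]
      ring
  have hfac' := congrArg (Nat.cast : ℕ → ZMod p) hfac
  push_cast at hfac'
  rw [hasc, ZMod.wilsons_lemma] at hfac'
  -- Wilson's theorem trades (p-j)! and (p-2j)! for (j-1)! and (2j-1)!.
  have w1 := ZMod.factorial_sub_mul_factorial (p := p) (j := j - 1) (by omega)
  have w2 := ZMod.factorial_sub_mul_factorial (p := p) (j := 2 * j - 1) (by omega)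
  rw [show p - 1 - (j - 1) = p - j by omega, show j - 1 + 1 = j by omega] at w1
  rw [show p - 1 - (2 * j - 1) = p - 2 * j by omega, show 2 * j - 1 + 1 = 2 * j by omega,
    pow_mul, neg_one_sq, one_pow] at w2
  have hb := congrArg (Nat.cast : ℕ → ZMod p)
    (Nat.choose_mul_factorial_mul_factorial (n := 2 * j) (k := j) (by omega))
  rw [show 2 * j - j = j by omega, ← Nat.centralBinom_eq_two_mul_choose,
    ← Nat.mul_factorial_pred h0.ne', ← Nat.mul_factorial_pred (n := 2 * j) (by omega)] at hb
  push_cast at hb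
  have e : ((-1 : ZMod p) ^ j) * (-1) ^ j = 1 := by
    rw [← mul_pow]
    simp
  have hj0 := ZMod.natCast_ne_zero_of_lt (p := p) h0 (by omega)
  have hf1 := hne (j - 1) (by omega)
  have hf2 := hne (2 * j - 1) (by omega)
  have hc' : (c : ZMod p) * (2 * j - 1).factorial = -((j - 1).factorial * (j - 1).factorial) := by
    have w1' : (((p - j).factorial : ZMod p) * (p - j).factorial) *
        ((j - 1).factorial * (j - 1).factorial) = 1 := by
      linear_combination (((p - j).factorial : ZMod p) * (j - 1).factorial + (-1) ^ j) * w1 + e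
    linear_combination (-(c : ZMod p) * (2 * j - 1).factorial) * w1' +
      (2 * j - 1).factorial * ((j - 1).factorial * (j - 1).factorial) * hfac' -
      ((j - 1).factorial * (j - 1).factorial) * w2
  have hb' : (j.centralBinom : ZMod p) * j * ((j - 1).factorial * (j - 1).factorial) =
      2 * (2 * j - 1).factorial := by
    refine mul_left_cancel₀ hj0 ?_
    linear_combination hb
  refine mul_right_cancel₀ (mul_ne_zero hf2 (mul_ne_zero hf1 hf1)) ?_
  linear_combination (j * j.centralBinom * ((j - 1).factorial * (j - 1).factorial : ZMod p)) * hc' -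
    ((j - 1).factorial * (j - 1).factorial : ZMod p) * hb'

theorem RatReducesTo.harmonicTwo {k : ℕ} (hk : k < p) :
    RatReducesTo p (harmonicTwo k) (∑ i ∈ Finset.range (k + 1), ((i : ZMod p)⁻¹) ^ 2) := by
  have h : (∑ i ∈ Finset.range (k + 1), ((i : ZMod p)⁻¹) ^ 2) =
      ∑ i ∈ Finset.Icc 1 k, ((i : ZMod p)⁻¹) ^ 2 := by
    rw [Finset.range_eq_Ico, Finset.sum_eq_sum_Ico_succ_bot (by omega)]
    simp [Finset.Ico_add_one_right_eq_Icc]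
  rw [h]
  refine RatReducesTo.sum fun i hi => ?_
  have hi' := Finset.mem_Icc.1 hi
  rw [one_div, ← inv_pow]
  exact (RatReducesTo.inv_natCast (ZMod.natCast_ne_zero_of_lt (by omega) (by omega))).pow 2

theorem ratReducesTo_sum_centralBinom (hpn : p = 2 * n + 1) (hp3 : 3 < p) :
    RatReducesTo p
      (∑ k ∈ Finset.range p, ((2 * k).choose k : ℚ) * harmonicTwo k / (2 : ℚ) ^ k)
      (-(eulerNumber (p - 3) : ZMod p)) := by
  have h : -(eulerNumber (p - 3) : ZMod p) =
      ∑ k ∈ Finset.range p, (k.centralBinom : ZMod p) *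
        (∑ i ∈ Finset.range (k + 1), ((i : ZMod p)⁻¹) ^ 2) * ((2 : ZMod p)⁻¹) ^ k := by
    rw [← sum_centralBinom_mul_harmonic_two hpn hp3]
    -- For n < k < p the term vanishes, since binom(n,k) = 0.
    refine Finset.sum_subset (Finset.range_subset_range.2 (by omega)) fun k hk hk' => ?_
    rw [Finset.mem_range] at hk hk'
    rw [ZMod.natCast_centralBinom hpn hk, Nat.choose_eq_zero_of_lt (by omega)]
    simp
  rw [h]
  refine RatReducesTo.sum fun k hk => ?_
  rw [div_eq_mul_inv, ← inv_pow, ← Nat.centralBinom_eq_two_mul_choose]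
  have h2 := RatReducesTo.inv_natCast (p := p) (m := 2)
    (ZMod.natCast_ne_zero_of_lt (by omega) (by omega))
  exact ((RatReducesTo.natCast _).mul (RatReducesTo.harmonicTwo (Finset.mem_range.1 hk))).mul
    ((by exact_mod_cast h2 : RatReducesTo p (2 : ℚ)⁻¹ (2 : ZMod p)⁻¹).pow k)

theorem ratReducesTo_lower_term {k : ℕ} (hpn : p = 2 * n + 1) (h0 : 0 < k) (hk : k ≤ n) :
    RatReducesTo p ((p : ℚ) * ((2 : ℚ) ^ k * harmonicTwo (k - 1) /
      ((k : ℚ) * ((2 * k).choose k : ℚ)))) 0 := by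
  have hp : p.Prime := Fact.out
  have hb : ((k * (2 * k).choose k : ℕ) : ZMod p) ≠ 0 := by
    rw [Ne, ZMod.natCast_eq_zero_iff, hp.dvd_mul, not_or]
    refine ⟨Nat.not_dvd_of_pos_of_lt h0 (by omega), fun h => ?_⟩
    have h1 := h.trans (Dvd.intro _ (Nat.choose_mul_factorial_mul_factorial
      (n := 2 * k) (k := k) (by omega) ▸ mul_assoc _ _ _).symm)
    rw [hp.dvd_factorial] at h1
    omega
  have h := (RatReducesTo.natCast (p := p) p).mul
    ((((RatReducesTo.natCast (p := p) 2).pow k).mul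
      (RatReducesTo.harmonicTwo (p := p) (k := k - 1) (by omega))).mul (RatReducesTo.inv_natCast hb))
  rw [ZMod.natCast_self, zero_mul] at h
  rw [div_eq_mul_inv]
  exact_mod_cast h

/-- The prefactor p cancels the p dividing the binomial coefficient. Then 2^(p-j) ≡ 2·2^(-j),
H_{p-j-1}^(2) ≡ -H_j^(2) and c·j·binom(2j,j) ≡ -2. -/
theorem ratReducesTo_upper_term {j : ℕ} (hpn : p = 2 * n + 1) (hp3 : 3 < p)
    (h0 : 0 < j) (hj : j ≤ n) :
    RatReducesTo p ((p : ℚ) * ((2 : ℚ) ^ (p - j) * harmonicTwo (p - j - 1) /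
      (((p - j : ℕ) : ℚ) * ((2 * (p - j)).choose (p - j) : ℚ))))
      (-((j.centralBinom : ZMod p) *
      (∑ i ∈ Finset.range (j + 1), ((i : ZMod p)⁻¹) ^ 2) * ((2 : ZMod p)⁻¹) ^ j)) := by
  have hp : p.Prime := Fact.out
  obtain ⟨c, hc, hcj⟩ := exists_centralBinom_sub_eq_mul hpn h0 hj
  have h2 := two_ne_zero_zmod hpn hp3
  have hj0 := ZMod.natCast_ne_zero_of_lt (p := p) h0 (by omega)
  have hc0 : (c : ZMod p) ≠ 0 := by
    intro h
    rw [h, zero_mul] at hcj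
    exact h2 (by linear_combination hcj)
  have hm : (((p - j) * c : ℕ) : ZMod p) ≠ 0 := by
    rw [Nat.cast_mul, ZMod.natCast_sub_self (by omega)]
    exact mul_ne_zero (neg_ne_zero.2 hj0) hc0
  have h := (((RatReducesTo.natCast (p := p) 2).pow (p - j)).mul
      (RatReducesTo.harmonicTwo (p := p) (k := p - j - 1) (by omega))).mul
        (RatReducesTo.inv_natCast hm)
  have hQ : (p : ℚ) * ((2 : ℚ) ^ (p - j) * harmonicTwo (p - j - 1) /
      (((p - j : ℕ) : ℚ) * ((2 * (p - j)).choose (p - j) : ℚ))) =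
      ((2 : ℕ) : ℚ) ^ (p - j) * harmonicTwo (p - j - 1) * (((p - j) * c : ℕ) : ℚ)⁻¹ := by
    rw [← Nat.centralBinom_eq_two_mul_choose, hc]
    have hp0 : (p : ℚ) ≠ 0 := Nat.cast_ne_zero.2 hp.ne_zero
    push_cast
    rw [div_eq_mul_inv, mul_inv, mul_inv, mul_inv]
    linear_combination ((2 : ℚ) ^ (p - j) * harmonicTwo (p - j - 1) *
      ((p - j : ℕ) : ℚ)⁻¹ * (c : ℚ)⁻¹) * mul_inv_cancel₀ hp0
  rw [hQ]
  convert h using 1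
  rw [show p - j - 1 + 1 = p - j by omega, sum_inv_sq_reflect hp3 (by omega), Nat.cast_mul,
    ZMod.natCast_sub_self (by omega)]
  have hpow : (2 : ZMod p) ^ (p - j) = 2 * (2⁻¹) ^ j := by
    have h1 : (2 : ZMod p) ^ (p - j) * 2 ^ j = 2 := by
      rw [← pow_add, Nat.sub_add_cancel (by omega), ZMod.pow_card]
    rw [inv_pow, ← div_eq_mul_inv, eq_div_iff (pow_ne_zero _ h2), h1]
  push_cast
  rw [hpow]
  generalize ∑ i ∈ Finset.range (j + 1), ((i : ZMod p)⁻¹) ^ 2 = t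
  field_simp
  linear_combination (-t) * hcj

theorem ratReducesTo_sum_inv_centralBinom (hpn : p = 2 * n + 1) (hp3 : 3 < p) :
    RatReducesTo p
      ((p : ℚ) * ∑ k ∈ Finset.Icc 1 (p - 1),
          (2 : ℚ) ^ k * harmonicTwo (k - 1) / ((k : ℚ) * ((2 * k).choose k : ℚ)))
      (eulerNumber (p - 3) : ZMod p) := by
  have hS := sum_centralBinom_mul_harmonic_two hpn hp3
  rw [Finset.sum_range_succ'] at hS
  simp only [zero_add, Finset.sum_range_one, Nat.cast_zero, inv_zero, ne_eq, OfNat.ofNat_ne_zero,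
    not_false_eq_true, zero_pow, mul_zero, zero_mul, add_zero] at hS
  -- Pairs each lower index k ≤ n with the upper index p - k.
  have hsplit : ∀ f : ℕ → ℚ, ∑ k ∈ Finset.Icc 1 (p - 1), f k =
      ∑ m ∈ Finset.range n, (f (m + 1) + f (p - (m + 1))) := by
    intro f
    have h := sum_range_two_mul_add_one hpn (fun k => if k = 0 then 0 else f k) (by simp)
    rw [Finset.sum_range_succ', if_pos rfl, add_zero, Finset.range_eq_Ico,
      Finset.sum_eq_sum_Ico_succ_bot (by omega), if_pos rfl, zero_add] at h
    have e : Finset.Icc 1 (p - 1) = Finset.Ico (0 + 1) p := by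
      ext
      simp only [Finset.mem_Icc, Finset.mem_Ico]
      omega
    rw [e]
    refine Eq.trans (Finset.sum_congr rfl fun k hk => ?_)
      (h.trans (Finset.sum_congr rfl fun k hk => ?_))
    · rw [Finset.mem_Ico] at hk
      rw [if_neg (by omega)]
    · rw [Finset.mem_range] at hk
      rw [if_neg (by omega), if_neg (by omega), if_neg (by omega)]
  rw [hsplit, Finset.mul_sum, ← neg_neg ((eulerNumber (p - 3) : ℤ) : ZMod p), ← hS,
    ← Finset.sum_neg_distrib]
  refine RatReducesTo.sum fun m hm => ?_
  have hm' := Finset.mem_range.1 hm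
  rw [mul_add]
  have h := (ratReducesTo_lower_term (p := p) (k := m + 1) hpn (by omega) (by omega)).add
    (ratReducesTo_upper_term (p := p) (j := m + 1) hpn hp3 (by omega) (by omega))
  rwa [zero_add] at h

end Prime

theorem theorem1p2 (p : ℕ) (hp : p.Prime) (hp3 : 3 < p) :
    RatModEq p
      (∑ k ∈ Finset.range p, ((2 * k).choose k : ℚ) * harmonicTwo k / (2 : ℚ) ^ k)
      (-(eulerNumber (p - 3) : ℚ)) ∧
    (RatModEq p
        (∑ k ∈ Finset.range p, ((2 * k).choose k : ℚ) * harmonicTwo k / (2 : ℚ) ^ k)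
        (-(eulerNumber (p - 3) : ℚ)) ↔
      RatModEq p
        ((p : ℚ) * ∑ k ∈ Finset.Icc 1 (p - 1),
          (2 : ℚ) ^ k * harmonicTwo (k - 1) / ((k : ℚ) * ((2 * k).choose k : ℚ)))
        (eulerNumber (p - 3) : ℚ)) := by
  have : Fact p.Prime := ⟨hp⟩
  obtain ⟨n, hpn⟩ := hp.odd_of_ne_two (by omega)
  have h1 := (ratReducesTo_sum_centralBinom hpn hp3).ratModEq
    (RatReducesTo.intCast (eulerNumber (p - 3))).neg
  have h2 := (ratReducesTo_sum_inv_centralBinom hpn hp3).ratModEq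
    (RatReducesTo.intCast (eulerNumber (p - 3)))
  exact ⟨h1, iff_of_true h1 h2⟩
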